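/- Let $n\ge 1$, let $T\colon\mathbb{R}^n\to\mathbb{R}^n$ be Gâteaux differentiable (for every $x$ there is a linear map $J_T(x)$, identified with its matrix, the Jacobian, such that $J_T(x)h=\lim_{t\to 0,\,t\neq 0}\frac{T(x+th)-T(x)}{t}$ for every $h\in\mathbb{R}^n$), and let $R_T=2T-I$ be its reflected operator, with Jacobian $J_{R_T}$. For a Gâteaux-differentiable operator $S$, write $J^{s}_S(x)=\tfrac12\big(J_S(x)+J_S(x)^\top\big)$; for a real symmetric matrix $M$, let $\overline{\lambda}_{\max}(M)$ be the maximum absolute value of the eigenvalues of $M$; and let $\succeq$ be the Loewner order on symmetric matrices. Let $\beta\ge 0$ and let, for every $x\in\mathbb{R}^n$, $\rho(x)\in\big[\overline{\lambda}_{\max}(J^{s}_{R_T}(x)),+\infty\big[$. The following properties are equivalent: 1. $T$ is $\beta$-strongly monotone, i.e. $\langle T(x)-T(y),\,x-y\rangle\ge\beta\|x-y\|^2$ for all $x,y\in\mathbb{R}^n$ (monotone, if $\beta=0$); 2. for every $x\in\mathbb{R}^n$, $J^{s}_T(x)\succeq\beta I$; 3. for every $x\in\mathbb{R}^n$, $J^{s}_{R_T}(x)\succeq(2\beta-1)I$;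 4. for every $x\in\mathbb{R}^n$, $\rho(x)-\overline{\lambda}_{\max}\big(\rho(x)I-J^{s}_{R_T}(x)\big)\ge 2\beta-1$. In addition, if $\beta>0$ and these equivalent properties hold, then $T$ is invertible, i.e. a bijection of $\mathbb{R}^n$ onto itself. -/

import Mathlib

open scoped MatrixOrder

/-- `L` is the Gâteaux derivative of `T` at `x`: `L` is a (continuous) linear map and, for every
direction `h`, `(T (x + t h) - T x) / t` tends to `L h` as `t → 0`, `t ≠ 0`. -/
def HasGateauxDerivAt {n : ℕ} (T : EuclideanSpace ℝ (Fin n) → EuclideanSpace ℝ (Fin n))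
    (L : EuclideanSpace ℝ (Fin n) →L[ℝ] EuclideanSpace ℝ (Fin n))
    (x : EuclideanSpace ℝ (Fin n)) : Prop :=
  ∀ h : EuclideanSpace ℝ (Fin n), HasLineDerivAt ℝ T (L h) x h

/-- `T` is Gâteaux differentiable (at every point of `ℝⁿ`). -/
def GateauxDifferentiable {n : ℕ}
    (T : EuclideanSpace ℝ (Fin n) → EuclideanSpace ℝ (Fin n)) : Prop :=
  ∀ x : EuclideanSpace ℝ (Fin n), ∃ L : EuclideanSpace ℝ (Fin n) →L[ℝ] EuclideanSpace ℝ (Fin n),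
    HasGateauxDerivAt T L x

/-- The Jacobian matrix of `T` at `x`: its `(i, j)` entry is the `j`-th partial derivative of the
`i`-th component of `T` at `x`. -/
noncomputable def jacobian {n : ℕ} (T : EuclideanSpace ℝ (Fin n) → EuclideanSpace ℝ (Fin n))
    (x : EuclideanSpace ℝ (Fin n)) : Matrix (Fin n) (Fin n) ℝ :=
  Matrix.of fun i j => (lineDeriv ℝ T x (EuclideanSpace.single j (1 : ℝ))) i

/-- If `T` has a Gâteaux derivative at `x`, the Jacobian is the matrix of that derivative. -/
theorem HasGateauxDerivAt.jacobian_mulVec {n : ℕ}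
    {T : EuclideanSpace ℝ (Fin n) → EuclideanSpace ℝ (Fin n)}
    {L : EuclideanSpace ℝ (Fin n) →L[ℝ] EuclideanSpace ℝ (Fin n)}
    {x : EuclideanSpace ℝ (Fin n)} (hL : HasGateauxDerivAt T L x)
    (h : EuclideanSpace ℝ (Fin n)) :
    WithLp.toLp 2 (Matrix.mulVec (jacobian T x) h.ofLp) = L h := by
  have hh : h = ∑ j, h j • EuclideanSpace.single j (1 : ℝ) := by
    ext i
    simp [Finset.sum_apply, Pi.single_apply]
  have e : L h = ∑ j, h j • L (EuclideanSpace.single j (1 : ℝ)) := by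
    conv_lhs => rw [hh]
    simp [map_sum]
  rw [e]
  ext i
  simp only [Matrix.mulVec, dotProduct, jacobian, Matrix.of_apply, (hL _).lineDeriv]
  simp [Finset.sum_apply, mul_comm]

/-- The symmetric part `(M + Mᵀ) / 2` of a square matrix. -/
noncomputable def symmPart {n : ℕ} (M : Matrix (Fin n) (Fin n) ℝ) : Matrix (Fin n) (Fin n) ℝ :=
  (1 / 2 : ℝ) • (M + M.transpose)

/-- The maximum absolute value of the (real) eigenvalues of `M`. It is used for symmetric matrices
of positive size, whose set of eigenvalues is real, finite and nonempty. -/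
noncomputable def maxAbsEigenvalue {n : ℕ} (M : Matrix (Fin n) (Fin n) ℝ) : ℝ :=
  sSup {r : ℝ | ∃ μ : ℝ, Module.End.HasEigenvalue (Matrix.toLin' M) μ ∧ r = |μ|}

/-- The reflected operator `R_T = 2 T - I`. -/
def reflectedOperator {n : ℕ} (T : EuclideanSpace ℝ (Fin n) → EuclideanSpace ℝ (Fin n)) :
    EuclideanSpace ℝ (Fin n) → EuclideanSpace ℝ (Fin n) :=
  fun x => (2 : ℝ) • T x - x

/-- `T` is `β`-strongly monotone; for `β = 0` this is monotonicity. -/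
def StronglyMonotone {n : ℕ} (β : ℝ)
    (T : EuclideanSpace ℝ (Fin n) → EuclideanSpace ℝ (Fin n)) : Prop :=
  ∀ x y : EuclideanSpace ℝ (Fin n), inner ℝ (T x - T y) (x - y) ≥ β * ‖x - y‖ ^ 2

/-! Along a line, `⟨T (y + s h), h⟩` has derivative `⟨J h, h⟩`, so strong monotonicity is a lower
bound on the quadratic form of the Jacobian, which sees only its symmetric part. The reflected
operator has symmetric part `2 Jˢ - I`, an affine change of the same bound. As `ρ` bounds the
spectrum of that part, `N = ρ I - Jˢ_R` is positive semidefinite, so its largest absolute eigenvalue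
is its largest eigenvalue, and bounding it above bounds `Jˢ_R` below.

For bijectivity, `β ‖x - y‖ ≤ ‖T x - T y‖` gives injectivity. `T` need not be continuous, so
closedness of its range rests on Minty's argument. A nearest point of the range to `y` then has zero
residual. -/

open Filter Topology

/-! ### Quadratic forms and eigenvalue bounds -/

section Matrix

open Matrix

variable {n : ℕ}

theorem isHermitian_symmPart (M : Matrix (Fin n) (Fin n) ℝ) : (symmPart M).IsHermitian := by
  rw [Matrix.IsHermitian, conjTranspose_eq_transpose_of_trivial, symmPart, transpose_smul,
    transpose_add, transpose_transpose, add_comm]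

theorem dotProduct_symmPart_mulVec (M : Matrix (Fin n) (Fin n) ℝ) (v : Fin n → ℝ) :
    v ⬝ᵥ (symmPart M *ᵥ v) = v ⬝ᵥ (M *ᵥ v) := by
  have h : v ⬝ᵥ (Mᵀ *ᵥ v) = v ⬝ᵥ (M *ᵥ v) := by
    rw [mulVec_transpose, dotProduct_comm, dotProduct_mulVec]
  rw [symmPart, smul_mulVec, add_mulVec, dotProduct_smul, dotProduct_add, h, smul_eq_mul]
  ring

theorem smul_one_le_symmPart_iff (M : Matrix (Fin n) (Fin n) ℝ) (c : ℝ) :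
    c • (1 : Matrix (Fin n) (Fin n) ℝ) ≤ symmPart M ↔
      ∀ h : EuclideanSpace ℝ (Fin n),
        c * ‖h‖ ^ 2 ≤ inner ℝ (WithLp.toLp 2 (M *ᵥ h.ofLp)) h := by
  rw [Matrix.le_iff, posSemidef_iff_dotProduct_mulVec]
  have hH : (symmPart M - c • (1 : Matrix (Fin n) (Fin n) ℝ)).IsHermitian :=
    (isHermitian_symmPart M).sub (isHermitian_one.smul (IsSelfAdjoint.all c))
  have key (h : EuclideanSpace ℝ (Fin n)) :
      star h.ofLp ⬝ᵥ ((symmPart M - c • (1 : Matrix (Fin n) (Fin n) ℝ)) *ᵥ h.ofLp) =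
        inner ℝ (WithLp.toLp 2 (M *ᵥ h.ofLp)) h - c * ‖h‖ ^ 2 := by
    rw [← real_inner_self_eq_norm_sq, EuclideanSpace.inner_eq_star_dotProduct,
      EuclideanSpace.inner_eq_star_dotProduct, star_trivial, star_trivial, sub_mulVec,
      dotProduct_sub, dotProduct_symmPart_mulVec, smul_mulVec, one_mulVec, dotProduct_smul,
      smul_eq_mul]
  constructor
  · rintro ⟨-, h⟩ v
    have := h v.ofLp
    rw [key] at this
    linarith
  · refine fun h => ⟨hH, fun v => ?_⟩
    have := key (WithLp.toLp 2 v)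
    simp only at this
    rw [this]
    linarith [h (WithLp.toLp 2 v)]

theorem bddAbove_abs_eigenvalues (M : Matrix (Fin n) (Fin n) ℝ) :
    BddAbove {r : ℝ | ∃ μ : ℝ, Module.End.HasEigenvalue (Matrix.toLin' M) μ ∧ r = |μ|} := by
  have h := (Module.End.finite_hasEigenvalue (Matrix.toLin' M)).image (fun μ : ℝ => |μ|)
  refine h.bddAbove.mono ?_
  rintro r ⟨μ, hμ, rfl⟩
  exact ⟨μ, hμ, rfl⟩

theorem abs_le_maxAbsEigenvalue {M : Matrix (Fin n) (Fin n) ℝ} {μ : ℝ}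
    (hμ : Module.End.HasEigenvalue (Matrix.toLin' M) μ) : |μ| ≤ maxAbsEigenvalue M :=
  le_csSup (bddAbove_abs_eigenvalues M) ⟨μ, hμ, rfl⟩

theorem Matrix.IsHermitian.hasEigenvalue_toLin' {M : Matrix (Fin n) (Fin n) ℝ}
    (hM : M.IsHermitian) (i : Fin n) :
    Module.End.HasEigenvalue (Matrix.toLin' M) (hM.eigenvalues i) := by
  refine Module.End.hasEigenvalue_of_hasEigenvector
    (x := (hM.eigenvectorBasis i).ofLp) ⟨?_, fun h => ?_⟩
  · rw [Module.End.mem_eigenspace_iff, toLin'_apply]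
    exact hM.mulVec_eigenvectorBasis i
  · refine hM.eigenvectorBasis.orthonormal.ne_zero i ?_
    ext j
    exact congrFun h j

/-- A symmetric matrix is bounded above by any bound on the absolute values of its eigenvalues. -/
theorem posSemidef_smul_one_sub {M : Matrix (Fin n) (Fin n) ℝ} (hM : M.IsHermitian) {c : ℝ}
    (hc : maxAbsEigenvalue M ≤ c) : (c • (1 : Matrix (Fin n) (Fin n) ℝ) - M).PosSemidef := by
  have hH : (c • (1 : Matrix (Fin n) (Fin n) ℝ) - M).IsHermitian :=
    (isHermitian_one.smul (IsSelfAdjoint.all c)).sub hM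
  rw [hH.posSemidef_iff_eigenvalues_nonneg]
  intro i
  obtain ⟨v, hv⟩ := (hH.hasEigenvalue_toLin' i).exists_hasEigenvector
  have hv' := hv.apply_eq_smul
  rw [toLin'_apply, sub_mulVec, smul_mulVec, one_mulVec] at hv'
  -- An eigenvector of `c I - M` for `lam` is one of `M` for `c - lam`; hence `c - lam ≤ c`.
  have hμ : Module.End.HasEigenvalue (Matrix.toLin' M) (c - hH.eigenvalues i) := by
    refine Module.End.hasEigenvalue_of_hasEigenvector (x := v) ⟨?_, hv.2⟩
    rw [Module.End.mem_eigenspace_iff, toLin'_apply, sub_smul, ← hv', sub_sub_cancel]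
  have := (le_abs_self _).trans ((abs_le_maxAbsEigenvalue hμ).trans hc)
  rw [Pi.zero_apply]
  linarith

/-- Eigenvalues of `N` are nonnegative, so the absolute values disappear and only an upper bound
remains. -/
theorem maxAbsEigenvalue_le_iff (hn : 1 ≤ n) {N : Matrix (Fin n) (Fin n) ℝ} (hN : N.PosSemidef)
    {c : ℝ} : maxAbsEigenvalue N ≤ c ↔ (c • (1 : Matrix (Fin n) (Fin n) ℝ) - N).PosSemidef := by
  refine ⟨posSemidef_smul_one_sub hN.isHermitian, fun h => csSup_le ?_ ?_⟩
  -- The supremum needs a nonempty set of eigenvalues, whence `1 ≤ n`.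
  · exact ⟨_, _, hN.isHermitian.hasEigenvalue_toLin' ⟨0, hn⟩, rfl⟩
  · rintro r ⟨μ, hμ, rfl⟩
    obtain ⟨v, hv⟩ := hμ.exists_hasEigenvector
    have hv' := hv.apply_eq_smul
    rw [toLin'_apply] at hv'
    have h1 := hN.dotProduct_mulVec_nonneg v
    have h2 := h.dotProduct_mulVec_nonneg v
    rw [sub_mulVec, smul_mulVec, one_mulVec, hv', ← sub_smul, dotProduct_smul,
      smul_eq_mul] at h2
    rw [hv', dotProduct_smul, smul_eq_mul] at h1
    have hpos : 0 < star v ⬝ᵥ v := dotProduct_star_self_pos_iff.mpr hv.2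
    rw [abs_of_nonneg (nonneg_of_mul_nonneg_left h1 hpos)]
    linarith [nonneg_of_mul_nonneg_left h2 hpos]

end Matrix

/-! ### Monotonicity and directional derivatives -/

section Monotone

variable {n : ℕ} {T : EuclideanSpace ℝ (Fin n) → EuclideanSpace ℝ (Fin n)} {β : ℝ}

theorem HasGateauxDerivAt.hasDerivAt_line
    {L : EuclideanSpace ℝ (Fin n) →L[ℝ] EuclideanSpace ℝ (Fin n)}
    {y h : EuclideanSpace ℝ (Fin n)} {t : ℝ} (hL : HasGateauxDerivAt T L (y + t • h)) :
    HasDerivAt (fun s : ℝ => T (y + s • h)) (L h) t := by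
  have h1 : HasDerivAt (fun s : ℝ => T (y + t • h + s • h)) (L h) (t - t) := by
    rw [sub_self]
    exact hL h
  have h2 := h1.comp_sub_const t t
  refine h2.congr_of_eventuallyEq (Eventually.of_forall fun s => ?_)
  simp only
  congr 1
  module

theorem StronglyMonotone.le_inner_deriv (hm : StronglyMonotone β T)
    {L : EuclideanSpace ℝ (Fin n) →L[ℝ] EuclideanSpace ℝ (Fin n)}
    {x : EuclideanSpace ℝ (Fin n)} (hL : HasGateauxDerivAt T L x)
    (h : EuclideanSpace ℝ (Fin n)) : β * ‖h‖ ^ 2 ≤ inner ℝ (L h) h := by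
  have hlim := (hL h).tendsto_slope_zero_right.inner (𝕜 := ℝ) (tendsto_const_nhds (x := h))
  refine ge_of_tendsto hlim ?_
  filter_upwards [self_mem_nhdsWithin] with t (ht : 0 < t)
  have h1 := hm (x + t • h) x
  rw [add_sub_cancel_left, inner_smul_right, norm_smul, Real.norm_of_nonneg ht.le] at h1
  rw [real_inner_smul_left, ← div_eq_inv_mul, le_div_iff₀ ht]
  nlinarith

theorem stronglyMonotone_iff_le_inner_deriv
    {L : EuclideanSpace ℝ (Fin n) → EuclideanSpace ℝ (Fin n) →L[ℝ] EuclideanSpace ℝ (Fin n)}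
    (hL : ∀ x, HasGateauxDerivAt T (L x) x) :
    StronglyMonotone β T ↔ ∀ x h, β * ‖h‖ ^ 2 ≤ inner ℝ (L x h) h := by
  refine ⟨fun hm x => hm.le_inner_deriv (hL x), fun H x y => ?_⟩
  set h := x - y with hh
  -- Subtracting `s β ‖h‖²` makes the derivative nonnegative; comparing `s = 0` with `s = 1` gives
  -- the claim.
  have hd (t : ℝ) : HasDerivAt (fun s : ℝ => inner ℝ (T (y + s • h)) h - s * (β * ‖h‖ ^ 2))
      (inner ℝ (L (y + t • h) h) h - β * ‖h‖ ^ 2) t := by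
    have h1 := (hL (y + t • h)).hasDerivAt_line.inner ℝ (hasDerivAt_const t h)
    have h2 := h1.sub ((hasDerivAt_id t).mul_const (β * ‖h‖ ^ 2))
    rw [inner_zero_right, zero_add, one_mul] at h2
    exact h2
  have hmono := monotone_of_deriv_nonneg (fun t => (hd t).differentiableAt) fun t => by
    rw [(hd t).deriv, sub_nonneg]
    exact H _ _
  have h01 := hmono (zero_le_one (α := ℝ))
  have hx : y + (1 : ℝ) • h = x := by rw [hh]; module
  simp only [hx, zero_smul, add_zero, zero_mul, sub_zero, one_mul] at h01
  rw [inner_sub_left]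
  linarith

/-! ### Bijectivity -/

theorem StronglyMonotone.mul_norm_le (hm : StronglyMonotone β T)
    (x y : EuclideanSpace ℝ (Fin n)) : β * ‖x - y‖ ≤ ‖T x - T y‖ := by
  rcases (norm_nonneg (x - y)).eq_or_lt with h0 | h0
  · rw [← h0, mul_zero]
    exact norm_nonneg _
  · have := (hm x y).le.trans (real_inner_le_norm _ _)
    refine le_of_mul_le_mul_right ?_ h0
    linarith

/-- The graph of a monotone operator that is continuous along lines is closed. -/
theorem StronglyMonotone.eq_of_tendsto (hβ : 0 ≤ β) (hm : StronglyMonotone β T)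
    (hT : GateauxDifferentiable T) {u : ℕ → EuclideanSpace ℝ (Fin n)}
    {x w : EuclideanSpace ℝ (Fin n)} (hu : Tendsto u atTop (𝓝 x))
    (hTu : Tendsto (fun k => T (u k)) atTop (𝓝 w)) : T x = w := by
  have hmon (z) : 0 ≤ inner ℝ (w - T z) (x - z) := by
    refine ge_of_tendsto' ((hTu.sub_const (T z)).inner (hu.sub_const z)) fun k => ?_
    exact (by positivity : 0 ≤ β * ‖u k - z‖ ^ 2).trans (hm _ _)
  obtain ⟨L, hL⟩ := hT x
  -- Minty's trick: test `hmon` at `x - t h`, divide by `t > 0` and let `t → 0`, which leaves `-‖h‖²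
  -- ≥ 0`.
  set h := T x - w with hh
  have hc : Tendsto (fun t : ℝ => T (x + t • (-h))) (𝓝[>] 0) (𝓝 (T x)) := by
    have : ContinuousAt (fun t : ℝ => T (x + t • (-h))) 0 := (hL (-h)).continuousAt
    have h2 := this.tendsto
    rw [zero_smul, add_zero] at h2
    exact h2.mono_left nhdsWithin_le_nhds
  have hlim := (hc.const_sub w).inner (𝕜 := ℝ) (tendsto_const_nhds (x := h))
  have hge : 0 ≤ inner ℝ (w - T x) h := by
    refine ge_of_tendsto hlim ?_
    filter_upwards [self_mem_nhdsWithin] with t (ht : 0 < t)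
    have h1 := hmon (x + t • (-h))
    have h2 : x - (x + t • (-h)) = t • h := by module
    rw [h2, inner_smul_right] at h1
    exact nonneg_of_mul_nonneg_right h1 ht
  rw [← neg_sub, ← hh, inner_neg_left, real_inner_self_eq_norm_sq] at hge
  have : ‖h‖ = 0 := by nlinarith [norm_nonneg h]
  exact sub_eq_zero.mp (norm_eq_zero.mp this)

theorem StronglyMonotone.injective (hβ : 0 < β) (hm : StronglyMonotone β T) :
    Function.Injective T := fun x y hxy => by
  have h := hm.mul_norm_le x y
  rw [hxy, sub_self, norm_zero] at h
  exact sub_eq_zero.mp (norm_le_zero_iff.mp (nonpos_of_mul_nonpos_right h hβ))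

/-- Expansiveness makes preimages of a convergent sequence Cauchy; the closed graph identifies the
limit. -/
theorem StronglyMonotone.isClosed_range (hβ : 0 < β) (hm : StronglyMonotone β T)
    (hT : GateauxDifferentiable T) : IsClosed (Set.range T) := by
  refine IsSeqClosed.isClosed fun v w hv hw => ?_
  choose u hu using hv
  have hcau : CauchySeq u := by
    rw [Metric.cauchySeq_iff']
    intro ε hε
    obtain ⟨N, hN⟩ := Metric.cauchySeq_iff'.mp hw.cauchySeq (β * ε) (by positivity)
    refine ⟨N, fun k hk => ?_⟩
    have h1 := hN k hk
    rw [dist_eq_norm, ← hu, ← hu] at h1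
    rw [dist_eq_norm]
    exact lt_of_mul_lt_mul_left ((hm.mul_norm_le _ _).trans_lt h1) hβ.le
  obtain ⟨x, hx⟩ := cauchySeq_tendsto_of_complete hcau
  exact ⟨x, hm.eq_of_tendsto hβ.le hT hx (by simpa only [hu] using hw)⟩

/-- The point of the range closest to `y` is `y` itself, by the first-order condition in the
direction of the residual. -/
theorem StronglyMonotone.surjective (hβ : 0 < β) (hm : StronglyMonotone β T)
    (hT : GateauxDifferentiable T) : Function.Surjective T := by
  intro y
  obtain ⟨_, ⟨x, rfl⟩, hx⟩ :=
    (hm.isClosed_range hβ hT).exists_infDist_eq_dist (Set.range_nonempty T) y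
  have hmin (z) : ‖T x - y‖ ≤ ‖T z - y‖ := by
    rw [← dist_eq_norm, ← dist_eq_norm, dist_comm, ← hx, dist_comm (T z)]
    exact Metric.infDist_le_dist_of_mem ⟨z, rfl⟩
  obtain ⟨L, hL⟩ := hT x
  set h := T x - y with hh
  have hd : HasDerivAt (fun t : ℝ => ‖T (x + t • h) - y‖ ^ 2)
      (2 * inner ℝ (T (x + (0 : ℝ) • h) - y) (L h)) 0 :=
    HasDerivAt.norm_sq (HasDerivAt.sub_const y (hL h))
  have hloc : IsLocalMin (fun t : ℝ => ‖T (x + t • h) - y‖ ^ 2) 0 := by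
    refine Eventually.of_forall fun t => ?_
    simp only [zero_smul, add_zero]
    exact pow_le_pow_left₀ (norm_nonneg _) (hmin _) 2
  have h0 := hloc.hasDerivAt_eq_zero hd
  rw [zero_smul, add_zero, ← hh, real_inner_comm] at h0
  -- Stationarity gives `⟨L h, h⟩ = 0`, while this inner product is at least `β ‖h‖²`.
  have h1 := hm.le_inner_deriv hL h
  have h2 : ‖h‖ ^ 2 ≤ 0 := nonpos_of_mul_nonpos_right (by linarith) hβ
  have : ‖h‖ = 0 := by nlinarith [norm_nonneg h]
  exact ⟨x, sub_eq_zero.mp (norm_eq_zero.mp this)⟩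

/-! ### The reflected operator and the equivalences -/

theorem jacobian_reflectedOperator (hT : GateauxDifferentiable T)
    (x : EuclideanSpace ℝ (Fin n)) :
    jacobian (reflectedOperator T) x = (2 : ℝ) • jacobian T x - 1 := by
  obtain ⟨L, hL⟩ := hT x
  have hR : ∀ h, HasLineDerivAt ℝ (reflectedOperator T) ((2 : ℝ) • L h - h) x h := fun h => by
    have h1 : HasDerivAt (fun t : ℝ => x + t • h) h 0 := by
      simpa using ((hasDerivAt_id (0 : ℝ)).smul_const h).const_add x
    exact (HasDerivAt.const_smul (2 : ℝ) (hL h)).sub h1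
  ext i j
  simp [jacobian, (hR _).lineDeriv, (hL _).lineDeriv, Matrix.one_apply]

theorem symmPart_jacobian_reflectedOperator (hT : GateauxDifferentiable T)
    (x : EuclideanSpace ℝ (Fin n)) :
    symmPart (jacobian (reflectedOperator T) x) = (2 : ℝ) • symmPart (jacobian T x) - 1 := by
  rw [jacobian_reflectedOperator hT, symmPart, symmPart, Matrix.transpose_sub,
    Matrix.transpose_smul, Matrix.transpose_one]
  module

end Monotone

theorem proposition3 {n : ℕ} (hn : 1 ≤ n)
    (T : EuclideanSpace ℝ (Fin n) → EuclideanSpace ℝ (Fin n))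
    (hT : GateauxDifferentiable T) (β : ℝ) (hβ : 0 ≤ β)
    (ρ : EuclideanSpace ℝ (Fin n) → ℝ)
    (hρ : ∀ x, maxAbsEigenvalue (symmPart (jacobian (reflectedOperator T) x)) ≤ ρ x) :
    List.TFAE [
      StronglyMonotone β T,
      ∀ x, symmPart (jacobian T x) ≥ β • (1 : Matrix (Fin n) (Fin n) ℝ),
      ∀ x, symmPart (jacobian (reflectedOperator T) x) ≥
        (2 * β - 1) • (1 : Matrix (Fin n) (Fin n) ℝ),
      ∀ x, ρ x - maxAbsEigenvalue
          (ρ x • (1 : Matrix (Fin n) (Fin n) ℝ) - symmPart (jacobian (reflectedOperator T) x)) ≥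
        2 * β - 1] ∧
    (0 < β → StronglyMonotone β T → Function.Bijective T) := by
  refine ⟨?_, fun h hm => ⟨hm.injective h, hm.surjective h hT⟩⟩
  tfae_have 1 ↔ 2 := by
    choose L hL using hT
    rw [stronglyMonotone_iff_le_inner_deriv hL]
    refine forall_congr' fun x => ?_
    rw [ge_iff_le, smul_one_le_symmPart_iff]
    simp only [(hL x).jacobian_mulVec]
  tfae_have 2 ↔ 3 := by
    refine forall_congr' fun x => ?_
    rw [ge_iff_le, ge_iff_le, symmPart_jacobian_reflectedOperator hT, Matrix.le_iff,
      Matrix.le_iff]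
    have h : (2 : ℝ) • symmPart (jacobian T x) - 1 -
        (2 * β - 1) • (1 : Matrix (Fin n) (Fin n) ℝ) =
        (2 : ℝ) • (symmPart (jacobian T x) - β • (1 : Matrix (Fin n) (Fin n) ℝ)) := by module
    rw [h]
    refine ⟨fun h => h.smul zero_le_two, fun h => ?_⟩
    simpa [smul_smul] using h.smul (show (0 : ℝ) ≤ 1 / 2 by norm_num)
  tfae_have 3 ↔ 4 := by
    refine forall_congr' fun x => ?_
    rw [ge_iff_le, ge_iff_le, le_sub_comm, maxAbsEigenvalue_le_iff hn
      (posSemidef_smul_one_sub (isHermitian_symmPart _) (hρ x)), Matrix.le_iff]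
    -- With `c = ρ x - (2 β - 1)`, the `ρ x` terms cancel in `c I - N`.
    refine iff_of_eq (congrArg _ ?_)
    module
  tfae_finish
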